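/- Theorem. Let $\mathcal H=\mathcal H_1\oplus\dots\oplus\mathcal H_m$ be a direct sum of real Hilbert spaces, and let $M:\mathcal H\to\mathcal H$ be a bounded, linear, self-adjoint and positive definite operator, in the sense that $\langle x,Mx\rangle\ge c\|x\|^2$ for all $x$ and some $c>0$ (so that $\langle x,y\rangle_M=\langle x,My\rangle$ is a Hilbert space inner product on $\mathcal H$; in finite dimension this is ordinary positive definiteness). Write $\|x\|_M=\sqrt{\langle x,Mx\rangle}$ and $\mathrm{Var}_M(X)=\mathbb E\|X\|_M^2-\|\mathbb E X\|_M^2$. Let $\theta\in(0,1]$ and let $T:\mathcal H\to\mathcal H$ be $\theta$-averaged with respect to $\|\cdot\|_M$, i.e. $T=(1-\theta)\mathrm{Id}+\theta C$ for some $C:\mathcal H\to\mathcal H$ with $\|Cx-Cy\|_M\le\|x-y\|_M$ for all $x,y$ (for $\theta=1$: $T$ is non-expansive). Let $v$ be the infimal displacement vector of $T$, i.e. the element of least $M$-norm of $\overline{\mathrm{range}(\mathrm{Id}-T)}$. For $s\in[0,1]^m$ and $u=(u_1,\dots,u_m)\in\mathcal H$ put $u_s=(s_1u_1,\dots,s_mu_m)$.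 Let $I^0,I^1,\dots$ be IID random vectors in $[0,1]^m$, distributed as $I$, with $\mathbb E[I]=\alpha\mathbf 1$ for some $\alpha\in(0,1]$, and assume that some $\beta>0$ with $\beta<\alpha/\theta$ satisfies $\mathbb E\|u_I\|_M^2\le\beta\|u\|_M^2$ for all $u\in\mathcal H$. Let $x^0\in\mathcal H$ be a (deterministic) starting point and $$x^{k+1}=x^k-\theta\,(Sx^k)_{I^k},\qquad S=\tfrac1\theta(\mathrm{Id}-T),\qquad k=0,1,2,\dots$$ Then every $x^k$ is square-integrable, and: (a) if $v\in\mathrm{range}(\mathrm{Id}-T)$, then $\displaystyle\limsup_{k\to\infty}k\,\mathbb E\left\|\frac{x^k}{k}+\alpha v\right\|_M^2\le(\beta-\alpha^2)\|v\|_M^2$; (b) in general, whether or not $v\in\mathrm{range}(\mathrm{Id}-T)$, $\displaystyle\limsup_{k\to\infty}k\,\mathrm{Var}_M\left(\frac{x^k}{k}\right)\le(\beta-\alpha^2)\|v\|_M^2$. -/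

import Mathlib

open MeasureTheory ProbabilityTheory Filter

namespace RCFPI

/-- Bounded, self-adjoint, positive definite operators. Positive definiteness is meant in the
sense (automatic in finite dimension) that makes `⟪x, M y⟫` an inner product of the Hilbert
space `H`, that is, one inducing an equivalent (hence complete) norm. -/
structure IsPosDefOperator {H : Type*} [NormedAddCommGroup H] [InnerProductSpace ℝ H]
    (M : H →L[ℝ] H) : Prop where
  symmetric : ∀ x y : H, inner ℝ (M x) y = inner ℝ x (M y)
  coercive : ∃ c : ℝ, 0 < c ∧ ∀ x : H, c * ‖x‖ ^ 2 ≤ inner ℝ x (M x)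

/-- The `M`-norm `‖x‖_M = √⟪x, M x⟫`. -/
noncomputable def mNorm {H : Type*} [NormedAddCommGroup H] [InnerProductSpace ℝ H]
    (M : H →L[ℝ] H) (x : H) : ℝ :=
  Real.sqrt (inner ℝ x (M x))

/-- The `M`-variance `E ‖X‖_M² - ‖E X‖_M²`. -/
noncomputable def mVar {H : Type*} [NormedAddCommGroup H] [InnerProductSpace ℝ H]
    {Ω : Type*} [MeasurableSpace Ω] (M : H →L[ℝ] H) (X : Ω → H) (μ : Measure Ω) : ℝ :=
  (∫ ω, mNorm M (X ω) ^ 2 ∂μ) - mNorm M (∫ ω, X ω ∂μ) ^ 2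

/-- Non-expansiveness with respect to the `M`-norm. -/
def IsNonexpansive {H : Type*} [NormedAddCommGroup H] [InnerProductSpace ℝ H]
    (M : H →L[ℝ] H) (C : H → H) : Prop :=
  ∀ x y : H, mNorm M (C x - C y) ≤ mNorm M (x - y)

/-- `T = (1 - θ) Id + θ C` for some `C` non-expansive in the `M`-norm; for `θ = 1` this says that
`T` itself is non-expansive. -/
def IsAveraged {H : Type*} [NormedAddCommGroup H] [InnerProductSpace ℝ H]
    (M : H →L[ℝ] H) (θ : ℝ) (T : H → H) : Prop :=
  ∃ C : H → H, IsNonexpansive M C ∧ ∀ x : H, T x = (1 - θ) • x + θ • C x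

/-- `v` is an element of least `M`-norm of the closure of the range of `Id - T`. -/
def IsInfimalDisplacement {H : Type*} [NormedAddCommGroup H] [InnerProductSpace ℝ H]
    (M : H →L[ℝ] H) (T : H → H) (v : H) : Prop :=
  v ∈ closure (Set.range fun x => x - T x) ∧
    ∀ y ∈ closure (Set.range fun x => x - T x), mNorm M v ≤ mNorm M y

/-- `u_s = (s₁ u₁, …, s_m u_m)` for a selection vector `s` and `u` in `H₁ ⊕ ⋯ ⊕ H_m`. -/
noncomputable def select {m : ℕ} {E : Fin m → Type*} [∀ i, NormedAddCommGroup (E i)]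
    [∀ i, InnerProductSpace ℝ (E i)] (s : Fin m → ℝ) (u : PiLp 2 E) : PiLp 2 E :=
  WithLp.toLp 2 fun i => s i • u i

/-- The randomized-coordinate operator `T_s = Id - θ S_s`, where `S = θ⁻¹ (Id - T)` and
`S_s x = (S x)_s`. -/
noncomputable def coordStep {m : ℕ} {E : Fin m → Type*} [∀ i, NormedAddCommGroup (E i)]
    [∀ i, InnerProductSpace ℝ (E i)] (θ : ℝ) (T : PiLp 2 E → PiLp 2 E) (s : Fin m → ℝ)
    (x : PiLp 2 E) : PiLp 2 E :=
  x - θ • select s (θ⁻¹ • (x - T x))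

/-- The iterates `x^{k+1} = T_{s^k} x^k` for a sequence `s^0, s^1, …` of selection vectors. -/
noncomputable def iterates {m : ℕ} {E : Fin m → Type*} [∀ i, NormedAddCommGroup (E i)]
    [∀ i, InnerProductSpace ℝ (E i)] (θ : ℝ) (T : PiLp 2 E → PiLp 2 E) (x₀ : PiLp 2 E)
    (s : ℕ → Fin m → ℝ) : ℕ → PiLp 2 E
  | 0 => x₀
  | k + 1 => coordStep θ T (s k) (iterates θ T x₀ s k)

end RCFPI

/-!
In the Hilbert space renormed by `M`, the displacement `g = Id - T` is cocoercive,
`‖g x - g y‖² ≤ 2 θ ⟪g x - g y, x - y⟫`, and one step of the iteration is `x ↦ x - P s (g x)`,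
where `P s u` is the selection `u_s`, of mean `α u` and second moment at most `β ‖u‖²`.

Compare the random iterates `x k` with the averaged iteration `y (k + 1) = y k - α g (y k)`. Write
`w = g (y k)`, `Δ = g (x k) - w`, `γ = β - α²`. Expanding the square, the conditional expectation
of `‖x (k + 1) - y (k + 1)‖²` is at most
`‖x k - y k‖² - 2 α ⟪Δ, x k - y k⟫ + β ‖Δ‖² + 2 γ ⟪Δ, w⟫ + γ ‖w‖²`. By cocoercivity the terms
quadratic in `Δ` amount to at most `-(α / θ - β) ‖Δ‖²`, with a strictly negative coefficient. If
`w` is close to `v`, then `⟪Δ, w⟫` may be replaced by `⟪Δ, v⟫` at a small cost, and `γ ‖w‖²` by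
`γ ‖v‖²`. The linear term `2 γ ⟪Δ, v⟫` has no sign, but `⟪x k - y k, v⟫` decreases by `α ⟪Δ, v⟫`
on average, so it disappears when the square is completed: with `z k = y k - (γ / α) v`,
`E ‖x (k + 1) - z (k + 1)‖² ≤ E ‖x k - z k‖² + γ ‖v‖² + K ε` (`one_step_estimate`,
`IsSelection.integral_norm_sub_meanIter_sq_le`).

Here `ε` measures how close `g (y 0)` comes to the least norm: if `‖g (y 0)‖² ≤ ‖v‖² + ε`, then the
same holds for all `g (y k)`, since displacements do not grow along `y` (`norm_meanIter_le`), and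
then `‖g (y k) - v‖² ≤ ε` by Pazy's inequality `‖v‖² ≤ ⟪g x, v⟫` (`norm_sq_le_inner_of_norm_min`).

The variance of `x k` is at most `E ‖x k - z k‖²`, which gives the second limit with `ε` arbitrarily
small. If `v = g (y 0)`, take `ε = 0`: then `y k = y 0 - k α v`, so `x k + k α v` differs from
`x k - z k` by a fixed vector, which is negligible after division by `√k`.
-/

open scoped Topology RealInnerProductSpace

namespace RCFPI

/-! ### Passing to the inner product of `M` -/

/-- The space `H` renormed by `M`: there is a Hilbert space `F`, isomorphic to `H` as a
topological vector space, whose inner product is `⟪x, M y⟫`. -/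
theorem IsPosDefOperator.exists_renorm.{u} {H : Type u} [NormedAddCommGroup H]
    [InnerProductSpace ℝ H] [CompleteSpace H] {M : H →L[ℝ] H} (hM : IsPosDefOperator M) :
    ∃ (F : Type u) (_ : NormedAddCommGroup F) (_ : InnerProductSpace ℝ F) (_ : CompleteSpace F)
      (e : H ≃L[ℝ] F), ∀ x y, inner ℝ (e x) (e y) = inner ℝ x (M y) := by
  obtain ⟨c, hc, hcM⟩ := hM.coercive
  let core : InnerProductSpace.Core ℝ H :=
    { inner := fun x y => inner ℝ x (M y)
      conj_inner_symm := fun x y => by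
        simpa [real_inner_comm] using hM.symmetric x y
      re_inner_nonneg := fun x => le_trans (by positivity) (hcM x)
      add_left := fun x y z => inner_add_left _ _ _
      smul_left := fun x y r => inner_smul_left _ _ _
      definite := fun x hx => by
        have h := hcM x
        have h' : c * ‖x‖ ^ 2 ≤ 0 := h.trans_eq hx
        have h2 : ‖x‖ ^ 2 ≤ 0 := by
          by_contra hn
          nlinarith [mul_pos hc (not_le.mp hn)]
        simpa using h2.antisymm (sq_nonneg _) }
  have hcont : ContinuousAt (fun x : H => core.inner x x) 0 := by
    have : Continuous fun x : H => (inner ℝ x (M x) : ℝ) := by fun_prop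
    exact this.continuousAt
  have hbdd : Bornology.IsVonNBounded ℝ {x : H | RCLike.re (core.inner x x) < 1} := by
    rw [NormedSpace.isVonNBounded_iff, isBounded_iff_forall_norm_le]
    refine ⟨√(1 / c), fun x hx => ?_⟩
    have hx' : inner ℝ x (M x) < (1 : ℝ) := hx
    refine Real.le_sqrt_of_sq_le ?_
    rw [le_div_iff₀ hc, mul_comm]
    exact (hcM x).trans hx'.le
  refine ⟨H, core.toNormedAddCommGroupOfTopology hcont hbdd,
    InnerProductSpace.ofCoreOfTopology core hcont hbdd, ?_,
    ContinuousLinearEquiv.refl ℝ H, fun x y => rfl⟩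
  -- the new norm induces the old uniformity, so that completeness is inherited
  have hU : (core.toNormedAddCommGroupOfTopology hcont hbdd).toMetricSpace.toUniformSpace
      = (inferInstance : UniformSpace H) := by
    refine IsUniformAddGroup.ext ?_ ?_ rfl
    · let := core.toNormedAddCommGroupOfTopology hcont hbdd
      infer_instance
    · infer_instance
  change @CompleteSpace H
    (core.toNormedAddCommGroupOfTopology hcont hbdd).toMetricSpace.toUniformSpace
  rw [hU]
  infer_instance

theorem mNorm_eq_norm {H F : Type*} [NormedAddCommGroup H] [InnerProductSpace ℝ H]
    [NormedAddCommGroup F] [InnerProductSpace ℝ F] {M : H →L[ℝ] H} {e : H ≃L[ℝ] F}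
    (he : ∀ x y, inner ℝ (e x) (e y) = inner ℝ x (M y)) (x : H) : mNorm M x = ‖e x‖ := by
  rw [mNorm, ← he, real_inner_self_eq_norm_sq, Real.sqrt_sq (norm_nonneg _)]

/-! ### The infimal displacement vector -/

section Deterministic

variable {F : Type*} [NormedAddCommGroup F] [InnerProductSpace ℝ F]

/-- The resolvent of `Id - T` at `0`, obtained as the fixed point of the contraction
`x ↦ (1 + t)⁻¹ T x`. -/
theorem exists_smul_add_sub_eq_zero [CompleteSpace F] {T : F → F}
    (hT : ∀ x y, ‖T x - T y‖ ≤ ‖x - y‖) {t : ℝ} (ht : 0 < t) :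
    ∃ x, t • x + (x - T x) = 0 := by
  have hC : ContractingWith (Real.toNNReal (1 + t)⁻¹) fun x => (1 + t)⁻¹ • T x := by
    refine ⟨?_, LipschitzWith.of_dist_le_mul fun x y => ?_⟩
    · rw [← NNReal.coe_lt_coe, Real.coe_toNNReal _ (by positivity)]
      exact inv_lt_one_of_one_lt₀ (by simpa using ht)
    · rw [dist_eq_norm, dist_eq_norm, ← smul_sub, norm_smul, Real.coe_toNNReal _ (by positivity),
        Real.norm_of_nonneg (by positivity)]
      exact mul_le_mul_of_nonneg_left (hT x y) (by positivity)
  obtain ⟨x, hx⟩ : ∃ x, (1 + t)⁻¹ • T x = x := ⟨_, hC.fixedPoint_isFixedPt⟩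
  refine ⟨x, ?_⟩
  have h : T x = (1 + t) • x := by
    rw [← inv_smul_eq_iff₀ (by positivity), hx]
  rw [h, add_smul, one_smul]
  abel

theorem inner_sub_sub_nonneg {T : F → F} (hT : ∀ x y, ‖T x - T y‖ ≤ ‖x - y‖) (x y : F) :
    0 ≤ ⟪(x - T x) - (y - T y), x - y⟫ := by
  have h1 : (x - T x) - (y - T y) = (x - y) - (T x - T y) := by abel
  rw [h1, inner_sub_left, real_inner_self_eq_norm_sq]
  have h2 := real_inner_le_norm (T x - T y) (x - y)
  nlinarith [hT x y, norm_nonneg (x - y)]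

/-- Pazy's inequality: the point `v` of least norm in the closure of `range (Id - T)` behaves like
a projection of `0`, although convexity of that closure is not assumed. The values
`a t = (Id - T) x_t` at the resolvent points `t x_t + (Id - T) x_t = 0` satisfy
`‖a t‖² ≤ ⟪(Id - T) x, a t⟫ + O(t)` for every `x`, by monotonicity, and this forces
`a t → v` as `t → 0`. -/
theorem norm_sq_le_inner_of_norm_min [CompleteSpace F] {T : F → F}
    (hT : ∀ x y, ‖T x - T y‖ ≤ ‖x - y‖) {v : F} (hv : v ∈ closure (Set.range fun x => x - T x))
    (hmin : ∀ x, ‖v‖ ≤ ‖x - T x‖) (x : F) : ‖v‖ ^ 2 ≤ ⟪x - T x, v⟫ := by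
  set t : ℕ → ℝ := fun n => 1 / ((n : ℝ) + 1) with ht
  have htpos : ∀ n, 0 < t n := fun n => Nat.one_div_pos_of_nat
  have htlim : Tendsto t atTop (𝓝 0) := tendsto_one_div_add_atTop_nhds_zero_nat
  choose z hz using fun n => exists_smul_add_sub_eq_zero hT (htpos n)
  set a : ℕ → F := fun n => z n - T (z n) with ha
  have haz : ∀ n, t n • z n = -a n := fun n => eq_neg_of_add_eq_zero_left (hz n)
  have key : ∀ n x, ‖a n‖ ^ 2 ≤ ⟪x - T x, a n⟫ + t n * ⟪(x - T x) - a n, x⟫ := by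
    intro n x
    have h := mul_nonneg (htpos n).le (inner_sub_sub_nonneg hT x (z n))
    rw [← real_inner_smul_right, smul_sub, haz n] at h
    change 0 ≤ ⟪(x - T x) - a n, t n • x - -a n⟫ at h
    rw [sub_neg_eq_add, inner_add_right, inner_smul_right, inner_sub_left _ _ (a n),
      real_inner_self_eq_norm_sq] at h
    linarith
  have hbd : ∀ n, ‖a n‖ ≤ ‖(0 : F) - T 0‖ := by
    intro n
    have h := key n 0
    rw [inner_zero_right, mul_zero, add_zero] at h
    have h2 := real_inner_le_norm ((0 : F) - T 0) (a n)
    rcases (norm_nonneg (a n)).eq_or_lt with h0 | h0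
    · rw [← h0]; positivity
    · exact le_of_mul_le_mul_right (by nlinarith) h0
  set G := ‖(0 : F) - T 0‖
  have hclose : ∀ n x, ‖a n - v‖ ^ 2
      ≤ 2 * (‖(x - T x) - v‖ * G + t n * ((‖x - T x‖ + G) * ‖x‖)) := by
    intro n x
    have h1 : ⟪x - T x, a n⟫ ≤ ⟪v, a n⟫ + ‖(x - T x) - v‖ * G := by
      have h := real_inner_le_norm ((x - T x) - v) (a n)
      rw [inner_sub_left] at h
      nlinarith [hbd n, norm_nonneg ((x - T x) - v)]
    have h2 : ⟪(x - T x) - a n, x⟫ ≤ (‖x - T x‖ + G) * ‖x‖ := by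
      refine (real_inner_le_norm _ _).trans (mul_le_mul_of_nonneg_right ?_ (norm_nonneg _))
      exact (norm_sub_le _ _).trans (by linarith [hbd n])
    have h3 := mul_le_mul_of_nonneg_left h2 (htpos n).le
    have h4 : ‖v‖ ^ 2 ≤ ‖a n‖ ^ 2 := pow_le_pow_left₀ (norm_nonneg _) (hmin (z n)) 2
    rw [norm_sub_sq_real, real_inner_comm]
    linarith [key n x]
  have hlim : Tendsto a atTop (𝓝 v) := by
    rw [tendsto_iff_norm_sub_tendsto_zero]
    suffices h : Tendsto (fun n => ‖a n - v‖ ^ 2) atTop (𝓝 0) by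
      simpa using h.sqrt
    refine tendsto_order.2 ⟨fun b hb => Eventually.of_forall fun n => hb.trans_le (sq_nonneg _),
      fun b hb => ?_⟩
    have hG : 0 ≤ G := norm_nonneg _
    obtain ⟨_, ⟨y, rfl⟩, hy⟩ := Metric.mem_closure_iff.1 hv (b / (4 * (G + 1))) (by positivity)
    rw [dist_comm, dist_eq_norm, lt_div_iff₀ (by positivity)] at hy
    have hl : Tendsto (fun n => 2 * (‖(y - T y) - v‖ * G + t n * ((‖y - T y‖ + G) * ‖y‖))) atTop
        (𝓝 (2 * (‖(y - T y) - v‖ * G + 0 * ((‖y - T y‖ + G) * ‖y‖)))) :=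
      ((htlim.mul_const _).const_add _).const_mul _
    have hlt : 2 * (‖(y - T y) - v‖ * G + 0 * ((‖y - T y‖ + G) * ‖y‖)) < b := by
      nlinarith [norm_nonneg ((y - T y) - v)]
    filter_upwards [hl.eventually (gt_mem_nhds hlt)] with n hn
    exact (hclose n y).trans_lt hn
  have h1 : Tendsto (fun n => ‖a n‖ ^ 2) atTop (𝓝 (‖v‖ ^ 2)) := hlim.norm.pow 2
  have h2 : Tendsto (fun n => ⟪x - T x, a n⟫ + t n * ⟪(x - T x) - a n, x⟫) atTop
      (𝓝 (⟪x - T x, v⟫ + 0 * ⟪(x - T x) - v, x⟫)) :=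
    (tendsto_const_nhds.inner hlim).add
      (htlim.mul ((tendsto_const_nhds.sub hlim).inner tendsto_const_nhds))
  simpa using le_of_tendsto_of_tendsto' h1 h2 fun n => key n x

/-! ### The averaged iteration -/

/-- The iteration `y ↦ y - α g y` driven by the mean of the selection vectors. -/
def meanIter (α : ℝ) (g : F → F) (y₀ : F) : ℕ → F
  | 0 => y₀
  | k + 1 => meanIter α g y₀ k - α • g (meanIter α g y₀ k)

/-- For `g` cocoercive, displacements do not grow along the averaged iteration, because
`Id - α g` is non-expansive. -/
theorem norm_meanIter_le {α θ : ℝ} {g : F → F} (hα : 0 < α) (hθ : 0 < θ) (hαθ : α * θ ≤ 1)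
    (hg : ∀ x y, ‖g x - g y‖ ^ 2 ≤ 2 * θ * ⟪g x - g y, x - y⟫) (y₀ : F) (k : ℕ) :
    ‖g (meanIter α g y₀ k)‖ ≤ ‖g y₀‖ := by
  have step : ∀ y, ‖g (y - α • g y)‖ ≤ ‖g y‖ := by
    intro y
    have h := hg y (y - α • g y)
    rw [sub_sub_cancel, inner_smul_right] at h
    -- with `a = g y` and `b = g (y - α g y)`, this reads `‖a - b‖² ≤ 2 α θ ⟪a - b, a⟫`
    set a := g y
    set b := g (y - α • a)
    have hnn : 0 ≤ ⟪a - b, a⟫ := by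
      have : 0 ≤ 2 * θ * (α * ⟪a - b, a⟫) := (sq_nonneg _).trans h
      exact (mul_nonneg_iff_of_pos_left (c := 2 * θ * α) (by positivity)).1 (by linarith)
    have h2 : ‖a - b‖ ^ 2 ≤ 2 * ⟪a - b, a⟫ := by nlinarith
    rw [norm_sub_sq_real, inner_sub_left, real_inner_self_eq_norm_sq, real_inner_comm] at h2
    exact le_of_sq_le_sq (by linarith) (norm_nonneg _)
  induction k with
  | zero => exact le_rfl
  | succ k ih => exact (step _).trans ih

/-- The estimate behind both limits. The left-hand side bounds the mean square distance of
`x - P s (g x)` to `y - α g y - κ v`, where `κ = (β - α²) / α`. Cocoercivity absorbs the terms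
quadratic in `Δ = g x - g y`, and `κ` is such that the linear terms `⟪Δ, v⟫` cancel. -/
theorem one_step_estimate {α β θ ε : ℝ} {g : F → F} {v x y : F} (hα : 0 < α) (hθ : 0 < θ)
    (hβα : β < α / θ) (hg : ‖g x - g y‖ ^ 2 ≤ 2 * θ * ⟪g x - g y, x - y⟫)
    (hvy : ‖v‖ ^ 2 ≤ ⟪g y, v⟫) (hε : ‖g y‖ ^ 2 ≤ ‖v‖ ^ 2 + ε) :
    ‖x - (y - ((β - α ^ 2) / α) • v) + α • g y‖ ^ 2
        - 2 * α * ⟪x - (y - ((β - α ^ 2) / α) • v) + α • g y, g x⟫ + β * ‖g x‖ ^ 2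
      ≤ ‖x - (y - ((β - α ^ 2) / α) • v)‖ ^ 2 + (β - α ^ 2) * ‖v‖ ^ 2
        + ((β - α ^ 2) ^ 2 / (α / θ - β) + |β - α ^ 2|) * ε := by
  set w := g y
  set γ := β - α ^ 2
  set c := α / θ - β
  have hc : 0 < c := sub_pos.2 hβα
  set Δ := g x - w with hΔ
  set e := x - (y - (γ / α) • v) with he
  have hgx : g x = Δ + w := by rw [hΔ]; abel
  have hed : e = (x - y) + (γ / α) • v := by rw [he]; abel
  have hexp : ‖e + α • w‖ ^ 2 - 2 * α * ⟪e + α • w, g x⟫ + β * ‖g x‖ ^ 2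
      = ‖e‖ ^ 2 - 2 * α * ⟪Δ, x - y⟫ + β * ‖Δ‖ ^ 2 + γ * ‖w‖ ^ 2
        + 2 * ⟪γ • Δ, w - v⟫ := by
    have h1 : ⟪e, Δ⟫ = ⟪Δ, x - y⟫ + γ / α * ⟪Δ, v⟫ := by
      rw [hed, inner_add_left, real_inner_smul_left, real_inner_comm, real_inner_comm Δ v]
    rw [hgx, norm_add_sq_real e, norm_add_sq_real Δ, norm_smul, mul_pow, Real.norm_eq_abs, sq_abs,
      inner_add_left, inner_add_right, inner_add_right, real_inner_smul_left, real_inner_smul_right,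
      real_inner_smul_left, real_inner_smul_left, real_inner_self_eq_norm_sq, h1,
      inner_sub_right Δ w v,
      real_inner_comm Δ w]
    have h2 : α * (γ / α) = γ := mul_div_cancel₀ _ hα.ne'
    have h3 : γ = β - α ^ 2 := rfl
    linear_combination (-2 * ⟪Δ, v⟫) * h2 - (2 * ⟪Δ, w⟫ + ‖w‖ ^ 2) * h3
  have hwv : ‖w - v‖ ^ 2 ≤ ε := by rw [norm_sub_sq_real]; linarith
  have hvw : 0 ≤ ‖w‖ ^ 2 - ‖v‖ ^ 2 := by
    have h := sq_nonneg ‖w - v‖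
    rw [norm_sub_sq_real] at h
    linarith
  have hmono : α / θ * ‖Δ‖ ^ 2 ≤ 2 * α * ⟪Δ, x - y⟫ := by
    rw [div_mul_eq_mul_div, div_le_iff₀ hθ]
    nlinarith
  have hyoung : 2 * ⟪γ • Δ, w - v⟫ ≤ c * ‖Δ‖ ^ 2 + γ ^ 2 / c * ε := by
    have h := sq_nonneg ‖c • Δ - γ • (w - v)‖
    rw [norm_sub_sq_real, norm_smul, norm_smul, mul_pow, mul_pow, Real.norm_eq_abs,
      Real.norm_eq_abs, sq_abs, sq_abs, real_inner_smul_left, real_inner_smul_right] at h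
    rw [real_inner_smul_left]
    have h2 : 2 * (γ * ⟪Δ, w - v⟫) * c ≤ c ^ 2 * ‖Δ‖ ^ 2 + γ ^ 2 * ε := by
      nlinarith [mul_le_mul_of_nonneg_left hwv (sq_nonneg γ)]
    refine ((le_div_iff₀ hc).2 h2).trans_eq ?_
    field_simp
  have habs : γ * (‖w‖ ^ 2 - ‖v‖ ^ 2) ≤ |γ| * ε :=
    mul_le_mul (le_abs_self γ) (by linarith) hvw (abs_nonneg γ)
  have hcΔ : c * ‖Δ‖ ^ 2 = α / θ * ‖Δ‖ ^ 2 - β * ‖Δ‖ ^ 2 := sub_mul _ _ _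
  rw [hexp]
  linarith

end Deterministic

/-! ### Iterations driven by independent random parameters -/

section RandomIteration

variable {S F : Type*}

/-- The iteration `x ↦ f (s k) x` driven by a sequence `s` of parameters. -/
def randIter (f : S → F → F) (x₀ : F) (s : ℕ → S) : ℕ → F
  | 0 => x₀
  | k + 1 => f (s k) (randIter f x₀ s k)

theorem randIter_congr (f : S → F → F) (x₀ : F) {s s' : ℕ → S} {k : ℕ}
    (h : ∀ n < k, s n = s' n) : randIter f x₀ s k = randIter f x₀ s' k := by
  induction k with
  | zero => rfl
  | succ k ih =>
    rw [randIter, randIter, h k k.lt_succ_self, ih fun n hn => h n (hn.trans k.lt_succ_self)]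

variable [NormedAddCommGroup F]

theorem continuous_randIter [TopologicalSpace S] {f : S → F → F}
    (hf : Continuous fun p : S × F => f p.1 p.2) (x₀ : F) (k : ℕ) :
    Continuous fun s : ℕ → S => randIter f x₀ s k := by
  induction k with
  | zero => exact continuous_const
  | succ k ih => exact hf.comp ((continuous_apply k).prodMk ih)

variable [MeasurableSpace S] {Ω : Type*} [MeasurableSpace Ω] {μ : Measure Ω}
  {ν : Measure S} {I : ℕ → Ω → S}

theorem exists_ae_norm_randIter_le {f : S → F → F}
    (hfb : ∀ R : ℝ, ∃ R' : ℝ, ∀ᵐ s ∂ν, ∀ x, ‖x‖ ≤ R → ‖f s x‖ ≤ R')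
    (hI : ∀ k, HasLaw (I k) ν μ) (x₀ : F) (k : ℕ) :
    ∃ R : ℝ, ∀ᵐ ω ∂μ, ‖randIter f x₀ (fun n => I n ω) k‖ ≤ R := by
  induction k with
  | zero => exact ⟨‖x₀‖, Eventually.of_forall fun _ => le_rfl⟩
  | succ k ih =>
    obtain ⟨R, hR⟩ := ih
    obtain ⟨R', hR'⟩ := hfb R
    rw [← (hI k).map_eq] at hR'
    refine ⟨R', ?_⟩
    filter_upwards [hR, ae_of_ae_map (hI k).aemeasurable hR'] with ω h1 h2
    exact h2 _ h1

variable [TopologicalSpace S] [SecondCountableTopology S] [BorelSpace S]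

/-- The `k`-th iterate depends on the first `k` parameters only, so it is independent of the
parameter used in the next step. -/
theorem indepFun_randIter [MeasurableSpace F] [BorelSpace F] {f : S → F → F}
    (hf : Continuous fun p : S × F => f p.1 p.2) (hI : ∀ k, HasLaw (I k) ν μ)
    (hind : iIndepFun I μ) (x₀ : F) (k : ℕ) :
    IndepFun (fun ω => randIter f x₀ (fun n => I n ω) k) (I k) μ := by
  by_cases hΩ : Nonempty Ω
  swap
  · rw [not_nonempty_iff] at hΩ
    rw [indepFun_iff_measure_inter_preimage_eq_mul]
    intro s t _ _
    simp [Set.eq_empty_of_isEmpty]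
  -- `s₀` serves to extend finite sequences of parameters to infinite ones
  have s₀ : S := I 0 hΩ.some
  have hdis : Disjoint (Finset.range k) {k} := by simp
  have h := hind.indepFun_finset₀ (Finset.range k) {k} hdis fun i => (hI i).aemeasurable
  let ext : (Finset.range k → S) → ℕ → S :=
    fun t n => if hn : n ∈ Finset.range k then t ⟨n, hn⟩ else s₀
  have hext : Continuous ext := by
    refine continuous_pi fun n => ?_
    by_cases hn : n ∈ Finset.range k
    · simpa only [ext, hn, dite_true] using continuous_apply _
    · simpa only [ext, hn, dite_false] using continuous_const
  have h2 := h.comp ((continuous_randIter hf x₀ k).comp hext).measurable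
    (measurable_pi_apply (⟨k, Finset.mem_singleton_self k⟩ : ({k} : Finset ℕ)))
  have h3 : (fun ω => randIter f x₀ (fun n => I n ω) k)
      = ((fun s => randIter f x₀ s k) ∘ ext) ∘ fun ω (i : Finset.range k) => I i ω := by
    funext ω
    refine randIter_congr f x₀ fun n hn => ?_
    simp [ext, hn]
  rw [h3]
  exact h2

variable [TopologicalSpace.PseudoMetrizableSpace S]

theorem aestronglyMeasurable_randIter {f : S → F → F}
    (hf : Continuous fun p : S × F => f p.1 p.2) (hI : ∀ k, HasLaw (I k) ν μ) (x₀ : F) (k : ℕ) :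
    AEStronglyMeasurable (fun ω => randIter f x₀ (fun n => I n ω) k) μ := by
  have h : AEMeasurable (fun ω n => I n ω) μ :=
    aemeasurable_pi_lambda _ fun n => (hI n).aemeasurable
  exact (continuous_randIter hf x₀ k).comp_aestronglyMeasurable h.aestronglyMeasurable

/-- Integrating out the parameter of the last step: a bound on the conditional expectation of
`φ` after one step, valid at every point, can be used along the iteration. -/
theorem integral_randIter_succ_le [IsFiniteMeasure μ] [SFinite ν] {f : S → F → F}
    (hf : Continuous fun p : S × F => f p.1 p.2) (hI : ∀ k, HasLaw (I k) ν μ)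
    (hind : iIndepFun I μ) (x₀ : F) (k : ℕ) {φ ψ : F → ℝ} (hφ : Continuous φ) (hψ : Continuous ψ)
    (hle : ∀ x, ∫ s, φ (f s x) ∂ν ≤ ψ x)
    (hφi : Integrable (fun ω => φ (randIter f x₀ (fun n => I n ω) (k + 1))) μ)
    (hψi : Integrable (fun ω => ψ (randIter f x₀ (fun n => I n ω) k)) μ) :
    ∫ ω, φ (randIter f x₀ (fun n => I n ω) (k + 1)) ∂μ
      ≤ ∫ ω, ψ (randIter f x₀ (fun n => I n ω) k) ∂μ := by
  borelize F
  set X : Ω → F := fun ω => randIter f x₀ (fun n => I n ω) k with hX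
  have hXm : AEMeasurable X μ := (aestronglyMeasurable_randIter hf hI x₀ k).aemeasurable
  have hIm := (hI k).aemeasurable
  have hmap : μ.map (fun ω => (X ω, I k ω)) = (μ.map X).prod ν := by
    rw [(indepFun_randIter hf hI hind x₀ k).map_prod_eq_prod_map_map hXm hIm, (hI k).map_eq]
  have hΦ : Continuous fun p : F × S => φ (f p.2 p.1) :=
    hφ.comp (hf.comp (continuous_snd.prodMk continuous_fst))
  have hΦm : ∀ ρ : Measure (F × S), AEStronglyMeasurable (fun p : F × S => φ (f p.2 p.1)) ρ :=
    fun ρ => hΦ.measurable.aestronglyMeasurable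
  have hpair : AEMeasurable (fun ω => (X ω, I k ω)) μ := hXm.prodMk hIm
  have hint : Integrable (fun p : F × S => φ (f p.2 p.1)) ((μ.map X).prod ν) := by
    rw [← hmap, integrable_map_measure (hΦm _) hpair]
    exact hφi
  have h1 : ∫ ω, φ (randIter f x₀ (fun n => I n ω) (k + 1)) ∂μ
      = ∫ y, ∫ s, φ (f s y) ∂ν ∂(μ.map X) := by
    rw [← integral_prod _ hint, ← hmap, integral_map hpair (hΦm _)]
    rfl
  have hψm : AEStronglyMeasurable ψ (μ.map X) := hψ.measurable.aestronglyMeasurable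
  rw [h1, ← integral_map hXm hψm]
  exact integral_mono hint.integral_prod_left ((integrable_map_measure hψm hXm).2 hψi) hle

end RandomIteration

/-! ### The stochastic estimate -/

section Selection

variable {S F : Type*} [NormedAddCommGroup F] [InnerProductSpace ℝ F]
  [TopologicalSpace S] [MeasurableSpace S]

/-- `P s u` is a random modification of `u` with mean `α u` and second moment at most `β ‖u‖²`,
continuous in both variables and bounded in terms of `‖u‖`. This is what the iteration needs to
know of the selection `u ↦ u_s`. -/
structure IsSelection (ν : Measure S) (P : S → F → F) (α β : ℝ) : Prop where
  continuous : Continuous fun p : S × F => P p.1 p.2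
  bound : ∃ K : ℝ, ∀ᵐ s ∂ν, ∀ u, ‖P s u‖ ≤ K * ‖u‖
  mean : ∀ u, ∫ s, P s u ∂ν = α • u
  second_moment : ∀ u, ∫ s, ‖P s u‖ ^ 2 ∂ν ≤ β * ‖u‖ ^ 2

variable {ν : Measure S} {P : S → F → F} {α β θ : ℝ} {g : F → F}

/-- The random step `x ↦ x - P s (g x)`. -/
def selStep (P : S → F → F) (g : F → F) (s : S) (x : F) : F := x - P s (g x)

/-- A cocoercive map is Lipschitz. -/
theorem lipschitzWith_of_cocoercive (hθ : 0 < θ)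
    (hg : ∀ x y, ‖g x - g y‖ ^ 2 ≤ 2 * θ * ⟪g x - g y, x - y⟫) :
    LipschitzWith (Real.toNNReal (2 * θ)) g := by
  refine LipschitzWith.of_dist_le_mul fun x y => ?_
  rw [dist_eq_norm, dist_eq_norm, Real.coe_toNNReal _ (by positivity)]
  rcases (norm_nonneg (g x - g y)).eq_or_lt with h0 | h0
  · rw [← h0]; positivity
  · refine le_of_mul_le_mul_left ?_ h0
    have h := mul_le_mul_of_nonneg_left (real_inner_le_norm (g x - g y) (x - y))
      (by positivity : 0 ≤ 2 * θ)
    nlinarith [hg x y]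

theorem IsSelection.continuous_selStep (hP : IsSelection ν P α β) (hg : Continuous g) :
    Continuous fun p : S × F => selStep P g p.1 p.2 :=
  continuous_snd.sub (hP.continuous.comp (continuous_fst.prodMk (hg.comp continuous_snd)))

variable [SecondCountableTopology S] [BorelSpace S] {Ω : Type*} [MeasurableSpace Ω] {μ : Measure Ω}
  [IsProbabilityMeasure μ]

theorem IsSelection.memLp_randIter [TopologicalSpace.PseudoMetrizableSpace S]
    {I : ℕ → Ω → S} (hP : IsSelection ν P α β) (hθ : 0 < θ)
    (hg : ∀ x y, ‖g x - g y‖ ^ 2 ≤ 2 * θ * ⟪g x - g y, x - y⟫)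
    (hI : ∀ k, HasLaw (I k) ν μ) (x₀ : F) (k : ℕ) :
    MemLp (fun ω => randIter (selStep P g) x₀ (fun n => I n ω) k) 2 μ := by
  have hL := lipschitzWith_of_cocoercive hθ hg
  obtain ⟨K, hK⟩ := hP.bound
  obtain ⟨R, hR⟩ := exists_ae_norm_randIter_le (f := selStep P g) (ν := ν) (fun R => by
    refine ⟨R + |K| * (‖g 0‖ + 2 * θ * R), ?_⟩
    filter_upwards [hK] with s hs x hx
    have h1 : ‖g x‖ ≤ ‖g 0‖ + 2 * θ * R := by
      have h := hL.dist_le_mul x 0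
      rw [dist_eq_norm, dist_zero_right, Real.coe_toNNReal _ (by positivity)] at h
      have h2 := norm_le_norm_add_norm_sub (g 0) (g x)
      have h3 : 2 * θ * ‖x‖ ≤ 2 * θ * R := by gcongr
      rw [norm_sub_rev] at h2
      linarith
    calc ‖selStep P g s x‖ ≤ ‖x‖ + ‖P s (g x)‖ := norm_sub_le _ _
      _ ≤ R + |K| * (‖g 0‖ + 2 * θ * R) := by
        refine add_le_add hx ((hs _).trans ?_)
        exact mul_le_mul (le_abs_self K) h1 (norm_nonneg _) (abs_nonneg K)) hI x₀ k
  exact MemLp.of_bound (aestronglyMeasurable_randIter (hP.continuous_selStep hL.continuous) hI x₀ k)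
    R hR

variable [IsProbabilityMeasure ν]

theorem IsSelection.memLp (hP : IsSelection ν P α β) (u : F) : MemLp (fun s => P s u) 2 ν := by
  obtain ⟨K, hK⟩ := hP.bound
  have hc : Continuous fun s => P s u := hP.continuous.comp (continuous_id.prodMk continuous_const)
  refine MemLp.of_bound hc.stronglyMeasurable.aestronglyMeasurable (K * ‖u‖) ?_
  filter_upwards [hK] with s hs using hs u

theorem IsSelection.integral_norm_sub_sq_le [CompleteSpace F] (hP : IsSelection ν P α β)
    (a u : F) :
    ∫ s, ‖a - P s u‖ ^ 2 ∂ν ≤ ‖a‖ ^ 2 - 2 * α * ⟪a, u⟫ + β * ‖u‖ ^ 2 := by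
  have hm := hP.memLp u
  have hi : Integrable (fun s => P s u) ν := hm.integrable (by norm_num)
  have hi1 : Integrable (fun s => ⟪a, P s u⟫) ν := hi.const_inner a
  have hi2 : Integrable (fun s => ‖P s u‖ ^ 2) ν := hm.integrable_norm_pow (by norm_num)
  have h1 : ∫ s, ⟪a, P s u⟫ ∂ν = α * ⟪a, u⟫ := by
    rw [integral_inner hi, hP.mean, real_inner_smul_right]
  have h2 : ∫ s, ‖a - P s u‖ ^ 2 ∂ν = ‖a‖ ^ 2 - 2 * (α * ⟪a, u⟫) + ∫ s, ‖P s u‖ ^ 2 ∂ν := by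
    have hi3 : Integrable (fun s => ‖a‖ ^ 2 - 2 * ⟪a, P s u⟫) ν :=
      (integrable_const _).sub (hi1.const_mul 2)
    simp_rw [norm_sub_sq_real]
    rw [integral_add hi3 hi2,
      integral_sub (integrable_const _) (hi1.const_mul 2), integral_const_mul, h1]
    simp
  rw [h2]
  linarith [hP.second_moment u]

/-- The Lyapunov estimate: the mean square distance of the random iteration to the averaged
iteration, corrected by a multiple of `v`, grows at most linearly in `k`. Each step is an
instance of `one_step_estimate`. -/
theorem IsSelection.integral_norm_sub_meanIter_sq_le [CompleteSpace F]
    [TopologicalSpace.PseudoMetrizableSpace S] {I : ℕ → Ω → S} (hP : IsSelection ν P α β)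
    (hα : 0 < α) (hθ : 0 < θ) (hαθ : α * θ ≤ 1) (hβα : β < α / θ)
    (hg : ∀ x y, ‖g x - g y‖ ^ 2 ≤ 2 * θ * ⟪g x - g y, x - y⟫)
    (hI : ∀ k, HasLaw (I k) ν μ) (hind : iIndepFun I μ) {v y₀ : F} {ε : ℝ}
    (hv : ∀ y, ‖v‖ ^ 2 ≤ ⟪g y, v⟫) (hε : ‖g y₀‖ ^ 2 ≤ ‖v‖ ^ 2 + ε) (x₀ : F) (k : ℕ) :
    ∫ ω, ‖randIter (selStep P g) x₀ (fun n => I n ω) k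
        - (meanIter α g y₀ k - ((β - α ^ 2) / α) • v)‖ ^ 2 ∂μ
      ≤ ‖x₀ - (y₀ - ((β - α ^ 2) / α) • v)‖ ^ 2 + k * ((β - α ^ 2) * ‖v‖ ^ 2
        + ((β - α ^ 2) ^ 2 / (α / θ - β) + |β - α ^ 2|) * ε) := by
  have hgc : Continuous g := (lipschitzWith_of_cocoercive hθ hg).continuous
  have hint : ∀ k (z : F), Integrable
      (fun ω => ‖randIter (selStep P g) x₀ (fun n => I n ω) k - z‖ ^ 2) μ := fun k z =>
    ((hP.memLp_randIter hθ hg hI x₀ k).sub (memLp_const z)).integrable_norm_pow (by norm_num)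
  induction k with
  | zero => simp [randIter, meanIter]
  | succ k ih =>
    set y := meanIter α g y₀ k
    set z := y - ((β - α ^ 2) / α) • v with hz
    set D := (β - α ^ 2) * ‖v‖ ^ 2 + ((β - α ^ 2) ^ 2 / (α / θ - β) + |β - α ^ 2|) * ε with hD
    have hstep : ∀ x, ∫ s, ‖selStep P g s x - (meanIter α g y₀ (k + 1) - ((β - α ^ 2) / α) • v)‖ ^ 2
        ∂ν ≤ ‖x - z‖ ^ 2 + D := by
      intro x
      have hrw : ∀ s, selStep P g s x - (meanIter α g y₀ (k + 1) - ((β - α ^ 2) / α) • v)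
          = (x - z + α • g y) - P s (g x) := by
        intro s
        change x - P s (g x) - (y - α • g y - ((β - α ^ 2) / α) • v) = _
        rw [hz]
        abel
      simp_rw [hrw]
      refine (hP.integral_norm_sub_sq_le _ _).trans ?_
      have hyε : ‖g y‖ ^ 2 ≤ ‖v‖ ^ 2 + ε := le_trans
        (pow_le_pow_left₀ (norm_nonneg _) (norm_meanIter_le hα hθ hαθ hg y₀ k) 2) hε
      rw [hD, ← add_assoc]
      exact one_step_estimate hα hθ hβα (hg x y) (hv y) hyε
    have h := integral_randIter_succ_le (hP.continuous_selStep hgc) hI hind x₀ k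
      (φ := fun x => ‖x - (meanIter α g y₀ (k + 1) - ((β - α ^ 2) / α) • v)‖ ^ 2)
      (ψ := fun x => ‖x - z‖ ^ 2 + D) (by fun_prop) (by fun_prop) hstep (hint _ _)
      ((hint k z).add (integrable_const D))
    refine h.trans ?_
    rw [integral_add (hint k z) (integrable_const D)]
    simp only [integral_const, probReal_univ, one_smul]
    push_cast
    linarith

/-- The variance is at most the mean square distance to any deterministic point. -/
theorem integral_norm_sq_sub_norm_integral_sq_le [CompleteSpace F] {X : Ω → F} (hX : MemLp X 2 μ)
    (z : F) :
    (∫ ω, ‖X ω‖ ^ 2 ∂μ) - ‖∫ ω, X ω ∂μ‖ ^ 2 ≤ ∫ ω, ‖X ω - z‖ ^ 2 ∂μ := by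
  have hi : Integrable X μ := hX.integrable (by norm_num)
  have hi1 : Integrable (fun ω => ⟪z, X ω⟫) μ := hi.const_inner z
  have hi2 : Integrable (fun ω => ‖X ω‖ ^ 2) μ := hX.integrable_norm_pow (by norm_num)
  have h : ∫ ω, ‖X ω - z‖ ^ 2 ∂μ = (∫ ω, ‖X ω‖ ^ 2 ∂μ) - 2 * ⟪z, ∫ ω, X ω ∂μ⟫ + ‖z‖ ^ 2 := by
    have hi3 : Integrable (fun ω => ‖X ω‖ ^ 2 - 2 * ⟪z, X ω⟫) μ := hi2.sub (hi1.const_mul 2)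
    simp_rw [norm_sub_sq_real, real_inner_comm z]
    rw [integral_add hi3 (integrable_const _),
      integral_sub hi2 (hi1.const_mul 2), integral_const_mul, integral_inner hi]
    simp
  have h2 := sq_nonneg ‖(∫ ω, X ω ∂μ) - z‖
  rw [norm_sub_sq_real, real_inner_comm] at h2
  rw [h]
  linarith

end Selection

/-! ### Limits -/

theorem limsup_coe_le_of_forall_eventually_le {u : ℕ → ℝ} {L : ℝ}
    (h : ∀ η > 0, ∀ᶠ k in atTop, u k ≤ L + η) :
    limsup (fun k => (u k : EReal)) atTop ≤ (L : EReal) := by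
  refine EReal.le_of_forall_lt_iff_le.1 fun z hz => ?_
  have hz' : L < z := EReal.coe_lt_coe_iff.1 hz
  refine limsup_le_of_le (by isBoundedDefault) ?_
  filter_upwards [h (z - L) (sub_pos.2 hz')] with k hk
  exact EReal.coe_le_coe_iff.2 (by linarith)

section Limits

variable {S F : Type*} [NormedAddCommGroup F] [InnerProductSpace ℝ F] [CompleteSpace F]
  [TopologicalSpace S] [TopologicalSpace.PseudoMetrizableSpace S] [SecondCountableTopology S]
  [MeasurableSpace S] [BorelSpace S] {ν : Measure S} [IsProbabilityMeasure ν]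
  {P : S → F → F} {α β θ : ℝ} {g : F → F}
  {Ω : Type*} [MeasurableSpace Ω] {μ : Measure Ω} [IsProbabilityMeasure μ] {I : ℕ → Ω → S}

/-- If `v` is attained, say `v = g y₀`, the averaged iteration from `y₀` is `y₀ - k α v`, so that
`x k + k α v` differs from the quantity in the Lyapunov estimate by a constant vector. -/
theorem IsSelection.eventually_mean_sq_le (hP : IsSelection ν P α β)
    (hα : 0 < α) (hθ : 0 < θ) (hαθ : α * θ ≤ 1) (hβα : β < α / θ)
    (hg : ∀ x y, ‖g x - g y‖ ^ 2 ≤ 2 * θ * ⟪g x - g y, x - y⟫)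
    (hI : ∀ k, HasLaw (I k) ν μ) (hind : iIndepFun I μ) {v : F}
    (hv : ∀ y, ‖v‖ ^ 2 ≤ ⟪g y, v⟫) (hvr : v ∈ Set.range g) (x₀ : F) {η : ℝ} (hη : 0 < η) :
    ∀ᶠ k : ℕ in atTop, (k : ℝ) * ∫ ω, ‖(k : ℝ)⁻¹ • randIter (selStep P g) x₀ (fun n => I n ω) k
        + α • v‖ ^ 2 ∂μ ≤ (β - α ^ 2) * ‖v‖ ^ 2 + η := by
  obtain ⟨y₀, hy₀⟩ := hvr
  set L := (β - α ^ 2) * ‖v‖ ^ 2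
  set κ := (β - α ^ 2) / α
  have hgy : ∀ k, g (meanIter α g y₀ k) = v := by
    intro k
    have h1 := pow_le_pow_left₀ (norm_nonneg _) (norm_meanIter_le hα hθ hαθ hg y₀ k) 2
    rw [hy₀] at h1
    have h2 : ‖g (meanIter α g y₀ k) - v‖ ^ 2 ≤ 0 := by
      rw [norm_sub_sq_real]
      linarith [hv (meanIter α g y₀ k)]
    have h3 : ‖g (meanIter α g y₀ k) - v‖ = 0 := by simpa using h2.antisymm (sq_nonneg _)
    exact sub_eq_zero.1 (norm_eq_zero.1 h3)
  have hy : ∀ k : ℕ, meanIter α g y₀ k = y₀ - (k : ℝ) • α • v := by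
    intro k
    induction k with
    | zero => simp [meanIter]
    | succ k ih =>
      rw [meanIter, hgy, ih, Nat.cast_succ, add_smul, one_smul]
      abel
  set A := ‖x₀ - (y₀ - κ • v)‖ ^ 2
  set b := y₀ - κ • v with hbdef
  obtain ⟨δ, hδ, hδL⟩ : ∃ δ : ℝ, 0 < δ ∧ δ * L ≤ η / 2 := by
    refine ⟨η / 2 / (|L| + 1), by positivity, ?_⟩
    rw [div_mul_eq_mul_div, div_le_iff₀ (by positivity)]
    nlinarith [le_abs_self L]
  set B := (1 + δ) * A + (1 + δ⁻¹) * ‖b‖ ^ 2 with hBdef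
  have hB : ∀ᶠ k : ℕ in atTop, B / (k : ℝ) < η / 2 :=
    (tendsto_const_div_atTop_nhds_zero_nat B).eventually (gt_mem_nhds (by positivity))
  filter_upwards [hB, eventually_gt_atTop 0] with k hk hk0
  have hk0' : (0 : ℝ) < k := Nat.cast_pos.2 hk0
  set X := fun ω => randIter (selStep P g) x₀ (fun n => I n ω) k
  set z := meanIter α g y₀ k - κ • v with hz
  have hX : MemLp X 2 μ := hP.memLp_randIter hθ hg hI x₀ k
  have hXz : Integrable (fun ω => ‖X ω - z‖ ^ 2) μ :=
    (hX.sub (memLp_const z)).integrable_norm_pow (by norm_num)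
  have hXi : Integrable (fun ω => ‖(k : ℝ)⁻¹ • X ω + α • v‖ ^ 2) μ :=
    ((hX.const_smul (k : ℝ)⁻¹).add (memLp_const (α • v))).integrable_norm_pow (by norm_num)
  have hpt : ∀ ω, (k : ℝ) * ‖(k : ℝ)⁻¹ • X ω + α • v‖ ^ 2
      ≤ (k : ℝ)⁻¹ * ((1 + δ) * ‖X ω - z‖ ^ 2 + (1 + δ⁻¹) * ‖b‖ ^ 2) := by
    intro ω
    have h1 : (k : ℝ)⁻¹ • X ω + α • v = (k : ℝ)⁻¹ • ((X ω - z) + b) := by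
      have hb : (X ω - z) + b = X ω + (k : ℝ) • α • v := by
        rw [hz, hy, hbdef]
        abel
      rw [hb, smul_add, inv_smul_smul₀ hk0'.ne']
    have h2 : ‖(X ω - z) + b‖ ^ 2 ≤ (1 + δ) * ‖X ω - z‖ ^ 2 + (1 + δ⁻¹) * ‖b‖ ^ 2 := by
      have h3 := norm_add_le (X ω - z) b
      have h4 := pow_le_pow_left₀ (norm_nonneg _) h3 2
      have h5 : 0 ≤ δ⁻¹ * (δ * ‖X ω - z‖ - ‖b‖) ^ 2 := by positivity
      have h6 : δ⁻¹ * (δ * ‖X ω - z‖ - ‖b‖) ^ 2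
          = δ * ‖X ω - z‖ ^ 2 - 2 * ‖X ω - z‖ * ‖b‖ + δ⁻¹ * ‖b‖ ^ 2 := by
        field_simp
        ring
      nlinarith
    rw [h1, norm_smul, mul_pow, norm_inv, Real.norm_of_nonneg hk0'.le]
    calc (k : ℝ) * ((k : ℝ)⁻¹ ^ 2 * ‖(X ω - z) + b‖ ^ 2) = (k : ℝ)⁻¹ * ‖(X ω - z) + b‖ ^ 2 := by
          field_simp
      _ ≤ _ := by gcongr
  have hlyap : ∫ ω, ‖X ω - z‖ ^ 2 ∂μ ≤ A + k * L := by
    have h := hP.integral_norm_sub_meanIter_sq_le hα hθ hαθ hβα hg hI hind hv (ε := 0)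
      (by rw [hy₀, add_zero]) x₀ k
    simpa only [mul_zero, add_zero] using h
  calc (k : ℝ) * ∫ ω, ‖(k : ℝ)⁻¹ • X ω + α • v‖ ^ 2 ∂μ
      = ∫ ω, (k : ℝ) * ‖(k : ℝ)⁻¹ • X ω + α • v‖ ^ 2 ∂μ := (integral_const_mul _ _).symm
    _ ≤ ∫ ω, (k : ℝ)⁻¹ * ((1 + δ) * ‖X ω - z‖ ^ 2 + (1 + δ⁻¹) * ‖b‖ ^ 2) ∂μ :=
        integral_mono (hXi.const_mul _)
          (((hXz.const_mul _).add (integrable_const _)).const_mul _) hpt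
    _ = (k : ℝ)⁻¹ * ((1 + δ) * ∫ ω, ‖X ω - z‖ ^ 2 ∂μ + (1 + δ⁻¹) * ‖b‖ ^ 2) := by
        rw [integral_const_mul, integral_add (hXz.const_mul _) (integrable_const _),
          integral_const_mul]
        simp
    _ ≤ (k : ℝ)⁻¹ * ((1 + δ) * (A + k * L) + (1 + δ⁻¹) * ‖b‖ ^ 2) := by gcongr
    _ = L + δ * L + B / k := by
        rw [hBdef]
        field_simp
        ring
    _ ≤ L + η := by linarith

/-- In general `v` is only approximated by values `g y₀`; the error `ε` this causes in the Lyapunov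
estimate can be made arbitrarily small. -/
theorem IsSelection.eventually_variance_le (hP : IsSelection ν P α β)
    (hα : 0 < α) (hθ : 0 < θ) (hαθ : α * θ ≤ 1) (hβα : β < α / θ)
    (hg : ∀ x y, ‖g x - g y‖ ^ 2 ≤ 2 * θ * ⟪g x - g y, x - y⟫)
    (hI : ∀ k, HasLaw (I k) ν μ) (hind : iIndepFun I μ) {v : F}
    (hv : ∀ y, ‖v‖ ^ 2 ≤ ⟪g y, v⟫) (hvr : v ∈ closure (Set.range g)) (x₀ : F) {η : ℝ}
    (hη : 0 < η) :
    ∀ᶠ k : ℕ in atTop,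
      (k : ℝ) * ((∫ ω, ‖(k : ℝ)⁻¹ • randIter (selStep P g) x₀ (fun n => I n ω) k‖ ^ 2 ∂μ)
        - ‖∫ ω, (k : ℝ)⁻¹ • randIter (selStep P g) x₀ (fun n => I n ω) k ∂μ‖ ^ 2)
        ≤ (β - α ^ 2) * ‖v‖ ^ 2 + η := by
  set L := (β - α ^ 2) * ‖v‖ ^ 2
  set κ := (β - α ^ 2) / α
  set K := (β - α ^ 2) ^ 2 / (α / θ - β) + |β - α ^ 2|
  have hK : 0 ≤ K := by
    have : 0 < α / θ - β := sub_pos.2 hβα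
    positivity
  obtain ⟨ε, hε, hKε⟩ : ∃ ε : ℝ, 0 < ε ∧ K * ε ≤ η / 2 := by
    refine ⟨η / 2 / (K + 1), by positivity, ?_⟩
    rw [mul_div_assoc', div_le_iff₀ (by positivity)]
    nlinarith
  obtain ⟨y₀, hy₀⟩ : ∃ y₀, ‖g y₀‖ ^ 2 < ‖v‖ ^ 2 + ε := by
    have hopen : IsOpen {w : F | ‖w‖ ^ 2 < ‖v‖ ^ 2 + ε} :=
      isOpen_lt (by fun_prop) continuous_const
    obtain ⟨_, hw, ⟨y₀, rfl⟩⟩ := mem_closure_iff.1 hvr _ hopen (by simpa using hε)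
    exact ⟨y₀, hw⟩
  set A := ‖x₀ - (y₀ - κ • v)‖ ^ 2
  have hA : ∀ᶠ k : ℕ in atTop, A / (k : ℝ) < η / 2 :=
    (tendsto_const_div_atTop_nhds_zero_nat A).eventually (gt_mem_nhds (by positivity))
  filter_upwards [hA, eventually_gt_atTop 0] with k hk hk0
  have hk0' : (0 : ℝ) < k := Nat.cast_pos.2 hk0
  set X := fun ω => randIter (selStep P g) x₀ (fun n => I n ω) k
  have hX : MemLp X 2 μ := hP.memLp_randIter hθ hg hI x₀ k
  have hlyap : ∫ ω, ‖X ω - (meanIter α g y₀ k - κ • v)‖ ^ 2 ∂μ ≤ A + k * (L + K * ε) :=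
    hP.integral_norm_sub_meanIter_sq_le hα hθ hαθ hβα hg hI hind hv hy₀.le x₀ k
  have hvar := (integral_norm_sq_sub_norm_integral_sq_le hX _).trans hlyap
  calc (k : ℝ) * ((∫ ω, ‖(k : ℝ)⁻¹ • X ω‖ ^ 2 ∂μ) - ‖∫ ω, (k : ℝ)⁻¹ • X ω ∂μ‖ ^ 2)
      = (k : ℝ)⁻¹ * ((∫ ω, ‖X ω‖ ^ 2 ∂μ) - ‖∫ ω, X ω ∂μ‖ ^ 2) := by
        simp_rw [norm_smul, mul_pow, integral_smul, norm_smul, mul_pow, integral_const_mul,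
          norm_inv, Real.norm_of_nonneg hk0'.le]
        field_simp
    _ ≤ (k : ℝ)⁻¹ * (A + k * (L + K * ε)) := by gcongr
    _ = L + K * ε + A / k := by
        field_simp
        ring
    _ ≤ L + η := by linarith

end Limits

/-! ### Selection of coordinates -/

section Coordinates

variable {m : ℕ} {E : Fin m → Type*} [∀ i, NormedAddCommGroup (E i)]
  [∀ i, InnerProductSpace ℝ (E i)]

theorem select_smul (s : Fin m → ℝ) (c : ℝ) (u : PiLp 2 E) :
    select s (c • u) = c • select s u := by
  ext i
  simp [select, smul_comm c]

theorem coordStep_eq {θ : ℝ} (hθ : θ ≠ 0) (T : PiLp 2 E → PiLp 2 E) (s : Fin m → ℝ)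
    (x : PiLp 2 E) : coordStep θ T s x = x - select s (x - T x) := by
  rw [coordStep, select_smul, smul_inv_smul₀ hθ]

theorem continuous_select :
    Continuous fun p : (Fin m → ℝ) × PiLp 2 E => select p.1 p.2 := by
  refine (PiLp.continuous_toLp 2 E).comp (continuous_pi fun i => ?_)
  exact ((continuous_apply i).comp continuous_fst).smul
    ((PiLp.continuous_apply 2 E i).comp continuous_snd)

theorem norm_select_le {s : Fin m → ℝ} (hs : ∀ i, s i ∈ Set.Icc (0 : ℝ) 1) (u : PiLp 2 E) :
    ‖select s u‖ ≤ ‖u‖ := by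
  refine le_of_sq_le_sq ?_ (norm_nonneg _)
  rw [PiLp.norm_sq_eq_of_L2, PiLp.norm_sq_eq_of_L2]
  refine Finset.sum_le_sum fun i _ => pow_le_pow_left₀ (norm_nonneg _) ?_ 2
  change ‖s i • u i‖ ≤ _
  rw [norm_smul, Real.norm_of_nonneg (hs i).1]
  exact mul_le_of_le_one_left (norm_nonneg _) (hs i).2

variable {ν : Measure (Fin m → ℝ)} [IsProbabilityMeasure ν]

theorem integral_select [∀ i, CompleteSpace (E i)] (hν : ∀ᵐ s ∂ν, ∀ i, s i ∈ Set.Icc (0 : ℝ) 1)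
    {α : ℝ} (hmean : ∀ i, ∫ s, s i ∂ν = α) (u : PiLp 2 E) : ∫ s, select s u ∂ν = α • u := by
  have hc : Continuous fun s : Fin m → ℝ => select s u :=
    continuous_select.comp (continuous_id.prodMk continuous_const)
  have hi : Integrable (fun s => select s u) ν := by
    refine Integrable.of_bound hc.stronglyMeasurable.aestronglyMeasurable ‖u‖ ?_
    filter_upwards [hν] with s hs using norm_select_le hs u
  ext i
  have h := (PiLp.proj (𝕜 := ℝ) 2 E i).integral_comp_comm hi
  change ∫ s : Fin m → ℝ, s i • u i ∂ν = _ at h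
  rw [integral_smul_const, hmean] at h
  exact h.symm

/-- Selection of coordinates, seen in the renormed space. -/
theorem isSelection_select [∀ i, CompleteSpace (E i)] {F : Type*} [NormedAddCommGroup F]
    [InnerProductSpace ℝ F] [CompleteSpace F] {M : PiLp 2 E →L[ℝ] PiLp 2 E} {e : PiLp 2 E ≃L[ℝ] F}
    (he : ∀ x y, inner ℝ (e x) (e y) = inner ℝ x (M y))
    (hν : ∀ᵐ s ∂ν, ∀ i, s i ∈ Set.Icc (0 : ℝ) 1) {α β : ℝ} (hmean : ∀ i, ∫ s, s i ∂ν = α)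
    (hbound : ∀ u : PiLp 2 E, ∫ s, mNorm M (select s u) ^ 2 ∂ν ≤ β * mNorm M u ^ 2) :
    IsSelection ν (fun s u => e (select s (e.symm u))) α β where
  continuous := e.continuous.comp (continuous_select.comp
    (continuous_fst.prodMk (e.symm.continuous.comp continuous_snd)))
  bound := by
    refine ⟨‖(e : PiLp 2 E →L[ℝ] F)‖ * ‖(e.symm : F →L[ℝ] PiLp 2 E)‖, ?_⟩
    filter_upwards [hν] with s hs u
    rw [mul_assoc]
    refine ((e : PiLp 2 E →L[ℝ] F).le_opNorm _).trans ?_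
    refine mul_le_mul_of_nonneg_left ?_ (norm_nonneg _)
    exact (norm_select_le hs _).trans ((e.symm : F →L[ℝ] PiLp 2 E).le_opNorm u)
  mean u := by
    rw [ContinuousLinearEquiv.integral_comp_comm, integral_select hν hmean, map_smul,
      e.apply_symm_apply]
  second_moment u := by
    have h := hbound (e.symm u)
    simp_rw [mNorm_eq_norm he] at h
    rwa [e.apply_symm_apply] at h

end Coordinates

/-- The displacement of an averaged operator is cocoercive. -/
theorem IsAveraged.cocoercive {H F : Type*} [NormedAddCommGroup H] [InnerProductSpace ℝ H]
    [NormedAddCommGroup F] [InnerProductSpace ℝ F] {M : H →L[ℝ] H} {e : H ≃L[ℝ] F}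
    (he : ∀ x y, inner ℝ (e x) (e y) = inner ℝ x (M y)) {θ : ℝ} {T : H → H}
    (hT : IsAveraged M θ T) (x y : H) :
    ‖e (x - T x) - e (y - T y)‖ ^ 2 ≤ 2 * θ * ⟪e (x - T x) - e (y - T y), e x - e y⟫ := by
  obtain ⟨C, hC, hTC⟩ := hT
  have h1 : e (x - T x) - e (y - T y) = θ • ((e x - e y) - (e (C x) - e (C y))) := by
    simp only [hTC, map_sub, map_add, map_smul]
    module
  have h2 := hC x y
  rw [mNorm_eq_norm he, mNorm_eq_norm he, map_sub, map_sub] at h2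
  have h3 := pow_le_pow_left₀ (norm_nonneg _) h2 2
  rw [h1, norm_smul, mul_pow, Real.norm_eq_abs, sq_abs, real_inner_smul_left, norm_sub_sq_real,
    inner_sub_left (e x - e y), real_inner_self_eq_norm_sq, real_inner_comm (e x - e y)]
  nlinarith [mul_le_mul_of_nonneg_left h3 (sq_nonneg θ)]

end RCFPI

theorem mainTheorem3 {m : ℕ} {E : Fin m → Type*} [∀ i, NormedAddCommGroup (E i)]
    [∀ i, InnerProductSpace ℝ (E i)] [∀ i, CompleteSpace (E i)]
    {Ω : Type*} [MeasurableSpace Ω] (μ : Measure Ω) [IsProbabilityMeasure μ]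
    (M : PiLp 2 E →L[ℝ] PiLp 2 E) (hM : RCFPI.IsPosDefOperator M)
    (θ : ℝ) (hθ : 0 < θ ∧ θ ≤ 1)
    (T : PiLp 2 E → PiLp 2 E) (hT : RCFPI.IsAveraged M θ T)
    (v : PiLp 2 E) (hv : RCFPI.IsInfimalDisplacement M T v)
    (ν : Measure (Fin m → ℝ)) (hν : ∀ᵐ s ∂ν, ∀ i, s i ∈ Set.Icc (0 : ℝ) 1)
    (I : ℕ → Ω → Fin m → ℝ) (hIlaw : ∀ k, HasLaw (I k) ν μ) (hIindep : iIndepFun I μ)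
    (α : ℝ) (hα : 0 < α ∧ α ≤ 1) (hmean : ∀ i, ∫ s, s i ∂ν = α)
    (β : ℝ) (hβ : 0 < β) (hβα : β < α / θ)
    (hbound : ∀ u : PiLp 2 E,
      ∫ s, RCFPI.mNorm M (RCFPI.select s u) ^ 2 ∂ν ≤ β * RCFPI.mNorm M u ^ 2)
    (x₀ : PiLp 2 E) (x : ℕ → Ω → PiLp 2 E)
    (hx : ∀ k ω, x k ω = RCFPI.iterates θ T x₀ (fun n => I n ω) k) :
    (∀ k, MemLp (x k) 2 μ) ∧
    (v ∈ Set.range (fun y => y - T y) →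
      limsup (fun k : ℕ =>
          (((k : ℝ) * ∫ ω, RCFPI.mNorm M ((k : ℝ)⁻¹ • x k ω + α • v) ^ 2 ∂μ : ℝ) : EReal)) atTop
        ≤ (((β - α ^ 2) * RCFPI.mNorm M v ^ 2 : ℝ) : EReal)) ∧
    limsup (fun k : ℕ =>
        (((k : ℝ) * RCFPI.mVar M (fun ω => (k : ℝ)⁻¹ • x k ω) μ : ℝ) : EReal)) atTop
      ≤ (((β - α ^ 2) * RCFPI.mNorm M v ^ 2 : ℝ) : EReal) := by
  obtain ⟨F, _, _, _, e, he⟩ := hM.exists_renorm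
  have : IsProbabilityMeasure ν := (hIlaw 0).isProbabilityMeasure_iff.1 inferInstance
  have hnorm := RCFPI.mNorm_eq_norm he
  set P : (Fin m → ℝ) → F → F := fun s u => e (RCFPI.select s (e.symm u))
  set g : F → F := fun u => e (e.symm u - T (e.symm u)) with hgdef
  have hP : RCFPI.IsSelection ν P α β := RCFPI.isSelection_select he hν hmean hbound
  have hg : ∀ a b, ‖g a - g b‖ ^ 2 ≤ 2 * θ * inner ℝ (g a - g b) (a - b) := by
    intro a b
    have h := hT.cocoercive he (e.symm a) (e.symm b)
    rwa [e.apply_symm_apply, e.apply_symm_apply] at h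
  have hge : ∀ y, g (e y) = e (y - T y) := fun y => by simp [hgdef]
  have hrange : Set.range g = e '' Set.range fun y => y - T y := by
    rw [← Set.range_comp, ← e.surjective.range_comp g]
    exact congrArg Set.range (funext hge)
  have hvcl : e v ∈ closure (Set.range g) := by
    rw [hrange]
    exact mem_closure_image e.continuous.continuousAt hv.1
  have hαθ : α * θ ≤ 1 := mul_le_one₀ hα.2 hθ.1.le hθ.2
  -- the displacement `g` comes from the non-expansive map `Id - g`, since `θ ≤ 1`
  have hnexp : ∀ a b, ‖(a - g a) - (b - g b)‖ ≤ ‖a - b‖ := by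
    intro a b
    refine le_of_sq_le_sq ?_ (norm_nonneg _)
    have h := hg a b
    have hnn : 0 ≤ inner ℝ (g a - g b) (a - b) :=
      (mul_nonneg_iff_of_pos_left (by linarith [hθ.1])).1 ((sq_nonneg _).trans h)
    have h1 : (a - g a) - (b - g b) = (a - b) - (g a - g b) := by abel
    rw [h1, norm_sub_sq_real, real_inner_comm]
    nlinarith [hθ.2]
  have hpazy : ∀ y, ‖e v‖ ^ 2 ≤ inner ℝ (g y) (e v) := by
    intro y
    have h := RCFPI.norm_sq_le_inner_of_norm_min hnexp (v := e v) (by simpa using hvcl)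
      (fun a => ?_) y
    · simpa using h
    · rw [sub_sub_cancel, ← hnorm, ← hnorm]
      exact hv.2 _ (subset_closure ⟨e.symm a, rfl⟩)
  have hiter : ∀ k ω, e (x k ω)
      = RCFPI.randIter (RCFPI.selStep P g) (e x₀) (fun n => I n ω) k := by
    intro k ω
    rw [hx]
    induction k with
    | zero => rfl
    | succ k ih =>
      rw [RCFPI.iterates, RCFPI.coordStep_eq hθ.1.ne', RCFPI.randIter, ← ih, RCFPI.selStep, hge,
        map_sub]
      simp [P]
  refine ⟨fun k => ?_, fun hvr => ?_, ?_⟩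
  · have h := (e.symm : F →L[ℝ] PiLp 2 E).comp_memLp' (hP.memLp_randIter hθ.1 hg hIlaw (e x₀) k)
    refine (memLp_congr_ae (Eventually.of_forall fun ω => ?_)).1 h
    simp [← hiter]
  · refine RCFPI.limsup_coe_le_of_forall_eventually_le fun η hη => ?_
    have h := hP.eventually_mean_sq_le hα.1 hθ.1 hαθ hβα hg hIlaw hIindep hpazy
      (hrange ▸ Set.mem_image_of_mem e hvr) (e x₀) hη
    simpa only [hnorm, map_add, map_smul, hiter] using h
  · refine RCFPI.limsup_coe_le_of_forall_eventually_le fun η hη => ?_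
    have h := hP.eventually_variance_le hα.1 hθ.1 hαθ hβα hg hIlaw hIindep hpazy hvcl (e x₀) hη
    simpa only [RCFPI.mVar, hnorm, ← ContinuousLinearEquiv.integral_comp_comm, map_smul, hiter]
      using h
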